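/- For sets $A,B\subseteq\mathbb N$ write $A\subseteq^* B$ if $A\setminus B$ is finite, and $A\subset^* B$ if $A\subseteq^* B$ and $B\setminus A$ is infinite. Write $A\le_{\mathrm{lex}}B$ if $A=B$ or the least element of the symmetric difference $A\,\triangle\,B$ belongs to $B$. A set $A\subseteq\mathbb N$ is called left-r.e. if there is a uniformly recursive sequence of sets $A_0,A_1,A_2,\ldots$ (that is, the relation $n\in A_s$ of $s$ and $n$ is decidable) such that $A_s\le_{\mathrm{lex}}A_{s+1}$ for all $s$ and $A_s$ converges pointwise to $A$ as $s\to\infty$. A left-r.e. set $A$ is called minimal if $\emptyset\subset^* A$ and there is no left-r.e. set $E$ with $\emptyset\subset^* E\subset^* A$. A left-r.e. set $B$ is called maximal if $B\subset^*\mathbb N$ and there is no left-r.e. set $E$ with $B\subset^* E\subset^*\mathbb N$. Theorem. There exist a minimal left-r.e. set $A$ and a maximal left-r.e. set $B$. -/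

import Mathlib

open Filter

/-- The order `A ≤_lex B` on sets of natural numbers: `A = B`, or the least element of the
symmetric difference of `A` and `B` belongs to `B`. -/
def LexLE (A B : Set ℕ) : Prop :=
  A = B ∨ ∃ x, IsLeast (symmDiff A B) x ∧ x ∈ B

/-- `A` is left-r.e.: it is the (pointwise) limit of a uniformly recursive sequence of sets
`A₀ ≤_lex A₁ ≤_lex A₂ ≤_lex ⋯`. -/
def LeftRE (A : Set ℕ) : Prop :=
  ∃ S : ℕ → Set ℕ,
    ComputablePred (fun p : ℕ × ℕ => p.2 ∈ S p.1) ∧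
    (∀ s, LexLE (S s) (S (s + 1))) ∧
    ∀ n, ∀ᶠ s in atTop, (n ∈ S s ↔ n ∈ A)

/-- `A ⊆* B`: almost all elements of `A` are in `B`. -/
def AlmostSubset (A B : Set ℕ) : Prop :=
  (A \ B).Finite

/-- `A ⊂* B`: almost all elements of `A` are in `B`, and infinitely many elements of `B` are
not in `A`. -/
def AlmostSSubset (A B : Set ℕ) : Prop :=
  AlmostSubset A B ∧ (B \ A).Infinite

/-- `A` is a minimal left-r.e. set: `∅ ⊂* A`, and `∅ ⊂* E ⊂* A` for no left-r.e. set `E`. -/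
def IsMinimalLeftRE (A : Set ℕ) : Prop :=
  LeftRE A ∧ AlmostSSubset ∅ A ∧
    ¬ ∃ E, LeftRE E ∧ AlmostSSubset ∅ E ∧ AlmostSSubset E A

/-- `B` is a maximal left-r.e. set: `B ⊂* ℕ`, and `B ⊂* E ⊂* ℕ` for no left-r.e. set `E`. -/
def IsMaximalLeftRE (B : Set ℕ) : Prop :=
  LeftRE B ∧ AlmostSSubset B Set.univ ∧
    ¬ ∃ E, LeftRE E ∧ AlmostSSubset B E ∧ AlmostSSubset E Set.univ

/-! Both sets come from one sparse set of marks. The digit at a base `b` fixes its single mark and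
the next base; a larger digit puts the mark earlier and the next base later, and makes the set of
marks lexicographically larger. Growing digits thus give a left-r.e. set of marks `A`, shrinking
digits a left-r.e. complement `B`.

It suffices that an infinite `D' ⊆*` marks, whose approximation `D t` is monotone in the direction
of the digits, contains almost all marks (`markSet_diff_finite`); for `B`, `D'` is the complement of
`E`. The core is `next_mark_notMem`: if `D'` misses a late mark it misses the next one, hence all
later ones, and is finite. To force this, the digit at `b` changes when program `e` shows some `D t`
that up to `k` is a guess `σ` for `D'` below `b` plus the single point `k`, in the block of the next
base. A growing digit moves the next base past `k`, leaving `D'` no point with which to stay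
lexicographically above `D t`. A shrinking digit moves the next mark before `k`, so that `D'`
containing it would exceed `D t`. Each tag `⟨e, σ⟩` acts at most once, so digits converge. -/

/-! ### Lexicographic order and monotone limits. -/

theorem lexLE_iff {A B : Set ℕ} :
    LexLE A B ↔ ∀ k, (∀ m < k, m ∈ A ↔ m ∈ B) → k ∈ A → k ∈ B := by
  constructor
  · rintro (rfl | ⟨x, ⟨hx, hmin⟩, hxB⟩) k hk hkA
    · exact hkA
    · by_contra hkB
      have hxk : x ≤ k := hmin (Or.inl ⟨hkA, hkB⟩)
      rcases hxk.lt_or_eq with h | rfl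
      · have := hk x h
        rcases hx with hx | hx <;> exact hx.2 (by tauto)
      · exact hkB hxB
  · intro h
    by_cases hAB : A = B
    · exact Or.inl hAB
    have hne : (symmDiff A B).Nonempty := by
      rw [Set.nonempty_iff_ne_empty]
      intro he
      exact hAB (symmDiff_eq_bot.1 he)
    have hleast : IsLeast (symmDiff A B) (sInf (symmDiff A B)) :=
      ⟨Nat.sInf_mem hne, fun _ hy => Nat.sInf_le hy⟩
    refine Or.inr ⟨_, hleast, ?_⟩
    have hbelow : ∀ m < sInf (symmDiff A B), m ∈ A ↔ m ∈ B := by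
      intro m hm
      have := Nat.notMem_of_lt_sInf hm
      rw [Set.mem_symmDiff] at this
      tauto
    rcases hleast.1 with hx | hx
    · exact h _ hbelow hx.1
    · exact hx.1

theorem LexLE.refl (A : Set ℕ) : LexLE A A := Or.inl rfl

/-- Where `A` and `C` agree below `k`, the set `B` squeezed between them agrees as well. -/
theorem LexLE.trans {A B C : Set ℕ} (hAB : LexLE A B) (hBC : LexLE B C) : LexLE A C := by
  rw [lexLE_iff] at *
  intro k hk hkA
  have hagree : ∀ m < k, m ∈ A ↔ m ∈ B := by
    intro m
    induction m using Nat.strong_induction_on with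
    | _ m ih =>
      intro hm
      have h1 := hAB m (fun i hi => ih i hi (hi.trans hm))
      have h2 := hBC m (fun i hi => by rw [← ih i hi (hi.trans hm)]; exact hk i (hi.trans hm))
      have h3 := hk m hm
      tauto
  exact hBC k (fun m hm => by rw [← hagree m hm]; exact hk m hm) (hAB k hagree hkA)

theorem LexLE.compl {A B : Set ℕ} (h : LexLE A B) : LexLE Bᶜ Aᶜ := by
  rw [lexLE_iff] at *
  intro k hk hkB hkA
  exact hkB (h k (fun m hm => not_iff_not.1 (hk m hm).symm) hkA)

theorem lexLE_of_le {S : ℕ → Set ℕ} (h : ∀ s, LexLE (S s) (S (s + 1))) {s t : ℕ} (hst : s ≤ t) :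
    LexLE (S s) (S t) := by
  induction t, hst using Nat.le_induction with
  | base => exact LexLE.refl _
  | succ t _ ih => exact ih.trans (h t)

theorem lexLE_of_succ_le {S : ℕ → Set ℕ} (h : ∀ s, LexLE (S (s + 1)) (S s)) {s t : ℕ}
    (hst : s ≤ t) : LexLE (S t) (S s) := by
  induction t, hst using Nat.le_induction with
  | base => exact LexLE.refl _
  | succ t _ ih => exact (h t).trans ih

theorem eventually_agree_le {S : ℕ → Set ℕ} {A : Set ℕ}
    (h : ∀ n, ∀ᶠ s in atTop, (n ∈ S s ↔ n ∈ A)) (k : ℕ) :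
    ∀ᶠ s in atTop, ∀ m ≤ k, (m ∈ S s ↔ m ∈ A) := by
  have := (Filter.eventually_all_finite (Set.finite_Iic k)).2 (fun m _ => h m)
  exact this

theorem lexLE_limit {S : ℕ → Set ℕ} {A : Set ℕ} (h : ∀ s, LexLE (S s) (S (s + 1)))
    (hlim : ∀ n, ∀ᶠ s in atTop, (n ∈ S s ↔ n ∈ A)) (t : ℕ) : LexLE (S t) A := by
  rw [lexLE_iff]
  intro k hk hkS
  obtain ⟨s, hs, hts⟩ := ((eventually_agree_le hlim k).and (eventually_ge_atTop t)).exists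
  exact (hs k le_rfl).1 (lexLE_iff.1 (lexLE_of_le h hts) k
    (fun m hm => (hk m hm).trans (hs m hm.le).symm) hkS)

theorem limit_lexLE {S : ℕ → Set ℕ} {A : Set ℕ} (h : ∀ s, LexLE (S (s + 1)) (S s))
    (hlim : ∀ n, ∀ᶠ s in atTop, (n ∈ S s ↔ n ∈ A)) (t : ℕ) : LexLE A (S t) := by
  rw [lexLE_iff]
  intro k hk hkA
  obtain ⟨s, hs, hts⟩ := ((eventually_agree_le hlim k).and (eventually_ge_atTop t)).exists
  exact lexLE_iff.1 (lexLE_of_succ_le h hts) k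
    (fun m hm => (hs m hm.le).trans (hk m hm)) ((hs k le_rfl).2 hkA)

/-! ### Bases, digits and marks. -/

/-- The number of tags available at the base `b`. -/
def tagBound (b : ℕ) : ℕ := 2 ^ b * 2 ^ b

/-- The least base above the interval of marks that belong to the base `b`. -/
def nextBase (b : ℕ) : ℕ := b + tagBound b + 1

/-- The sequence of bases determined by a digit `δ b` for each base `b`. -/
def base (δ : ℕ → ℕ) (n : ℕ) : ℕ := (fun b => nextBase^[δ b + 1] b)^[n] 0

/-- The mark belonging to the base `b`. -/
def markAt (δ : ℕ → ℕ) (b : ℕ) : ℕ := b + (tagBound b - δ b)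

/-- The set of marks of a digit function. -/
def markSet (δ : ℕ → ℕ) : Set ℕ := Set.range fun n => markAt δ (base δ n)

theorem base_succ (δ : ℕ → ℕ) (n : ℕ) :
    base δ (n + 1) = nextBase^[δ (base δ n) + 1] (base δ n) := by
  simp only [base, Function.iterate_succ_apply']

theorem lt_nextBase (b : ℕ) : b < nextBase b := by unfold nextBase; omega

theorem iterate_nextBase_strictMono (b : ℕ) : StrictMono fun x => nextBase^[x] b :=
  strictMono_nat_of_lt_succ fun x => by
    simp only [Function.iterate_succ_apply']
    exact lt_nextBase _

/-- Distinct digits lead to disjoint blocks: the block after the smaller digit ends before the base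
given by the larger. -/
theorem nextBase_iterate_le {x y : ℕ} (h : x < y) (b : ℕ) :
    nextBase (nextBase^[x + 1] b) ≤ nextBase^[y + 1] b := by
  rw [← Function.iterate_succ_apply' nextBase]
  exact (iterate_nextBase_strictMono b).monotone (by omega)

theorem nextBase_le_base_succ (δ : ℕ → ℕ) (n : ℕ) : nextBase (base δ n) ≤ base δ (n + 1) := by
  rw [base_succ]
  exact (iterate_nextBase_strictMono (base δ n)).monotone (show 1 ≤ δ (base δ n) + 1 by omega)

theorem base_strictMono (δ : ℕ → ℕ) : StrictMono (base δ) :=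
  strictMono_nat_of_lt_succ fun n => (lt_nextBase _).trans_le (nextBase_le_base_succ δ n)

theorem le_markAt (δ : ℕ → ℕ) (b : ℕ) : b ≤ markAt δ b := Nat.le_add_right _ _

theorem markAt_lt (δ : ℕ → ℕ) (b : ℕ) : markAt δ b < nextBase b := by
  unfold markAt nextBase; omega

theorem mark_strictMono (δ : ℕ → ℕ) : StrictMono fun n => markAt δ (base δ n) :=
  strictMono_nat_of_lt_succ fun n => (markAt_lt δ _).trans_le
    ((nextBase_le_base_succ δ n).trans (le_markAt δ _))

theorem markSet_infinite (δ : ℕ → ℕ) : (markSet δ).Infinite :=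
  Set.infinite_range_of_injective (mark_strictMono δ).injective

theorem eq_mark_of_mem {δ : ℕ → ℕ} {n m : ℕ} (hm : m ∈ markSet δ) (h1 : base δ n ≤ m)
    (h2 : m < base δ (n + 1)) : m = markAt δ (base δ n) := by
  obtain ⟨i, rfl⟩ := hm
  dsimp only at *
  have hi : i < n + 1 :=
    (base_strictMono δ).lt_iff_lt.1 ((le_markAt δ _).trans_lt h2)
  have hn : n < i + 1 := (base_strictMono δ).lt_iff_lt.1
    (h1.trans_lt ((markAt_lt δ _).trans_le (nextBase_le_base_succ δ i)))
  rw [show i = n by omega]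

theorem base_congr {δ δ' : ℕ → ℕ} {m : ℕ} (h : ∀ b ≤ m, δ b = δ' b) {n : ℕ}
    (hn : base δ n ≤ m) : base δ n = base δ' n := by
  induction n with
  | zero => rfl
  | succ n ih =>
    have hlt := (base_strictMono δ n.lt_succ_self).le.trans hn
    rw [base_succ, base_succ, ← ih hlt, h _ hlt]

/-- Whether `m` is a mark depends only on the digits at bases up to `m`; this turns convergence of
digits into convergence of sets. -/
theorem mem_markSet_of_agree {δ δ' : ℕ → ℕ} {m : ℕ} (h : ∀ b ≤ m, δ b = δ' b)
    (hm : m ∈ markSet δ) : m ∈ markSet δ' := by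
  obtain ⟨n, rfl⟩ := hm
  dsimp only at *
  have hb := le_markAt δ (base δ n)
  refine ⟨n, ?_⟩
  simp only [markAt, ← base_congr h hb, h _ hb]

theorem markSet_lexLE {δ δ' : ℕ → ℕ} (h : ∀ b, δ b ≤ δ' b) (hδ' : ∀ b, δ' b ≤ tagBound b) :
    LexLE (markSet δ) (markSet δ') := by
  rw [lexLE_iff]
  rintro k hk ⟨n, rfl⟩
  dsimp only at hk ⊢
  have key : ∀ i ≤ n, base δ i = base δ' i → δ (base δ i) = δ' (base δ i) := by
    intro i hi hb
    by_contra hne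
    have hlt : δ (base δ i) < δ' (base δ i) := lt_of_le_of_ne (h _) hne
    have hmark : markAt δ' (base δ i) < markAt δ (base δ i) := by
      have := hδ' (base δ i)
      unfold markAt
      omega
    -- The earlier mark of `δ'` would have to be a mark of `δ` too, but `δ` has only one mark in
    -- this block.
    have hmem := (hk (markAt δ' (base δ i))
      (hmark.trans_le ((mark_strictMono δ).monotone hi))).2 ⟨i, by simp only [hb]⟩
    have := eq_mark_of_mem hmem (le_markAt δ' _)
      (hmark.trans ((markAt_lt δ _).trans_le (nextBase_le_base_succ δ i)))
    omega
  have hbase : ∀ i ≤ n, base δ i = base δ' i := by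
    intro i
    induction i with
    | zero => intro _; rfl
    | succ i ih =>
      intro hi
      have hb := ih (by omega)
      rw [base_succ, base_succ, ← hb, key i (by omega) hb]
  refine ⟨n, ?_⟩
  simp only [markAt, ← hbase n le_rfl, key n le_rfl (hbase n le_rfl)]

/-! ### Using up tags, and convergence of the digits. -/

/-- The computation recorded by `s = ⟨q, k, t, u⟩` with `q = ⟨e, σ⟩` shows, within `u` steps, that
the set computed by the program `e` at time `t` meets `[0, k]` in `k` and the part of the bit mask
`σ` below `b`, where `k` lies between the base that follows `b` under the digit `x` and the least
base after that. -/
def Shows (b x s : ℕ) : Prop :=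
  nextBase^[x + 1] b ≤ s.unpair.2.unpair.1 ∧ s.unpair.2.unpair.1 < nextBase^[x + 2] b ∧
    ∀ m < s.unpair.2.unpair.1 + 1,
      Nat.Partrec.Code.evaln s.unpair.2.unpair.2.unpair.2
        (Denumerable.ofNat Nat.Partrec.Code s.unpair.1.unpair.1)
        (Nat.pair s.unpair.2.unpair.2.unpair.1 m) =
      some (if (m < b ∧ s.unpair.1.unpair.2 / 2 ^ m % 2 = 1) ∨ m = s.unpair.2.unpair.1
        then 1 else 0)

open Classical in
/-- The tags used up at the base `b` before stage `s`, where `dig b j` is the digit at `b` after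
`j` tags have been used. -/
noncomputable def tags (dig : ℕ → ℕ → ℕ) (b : ℕ) : ℕ → List ℕ
  | 0 => []
  | s + 1 =>
    if s.unpair.1 < tagBound b ∧ s.unpair.1 ∉ tags dig b s ∧ Shows b (dig b (tags dig b s).length) s
    then s.unpair.1 :: tags dig b s else tags dig b s

/-- The digit at the base `b` at stage `s`. -/
noncomputable def digit (dig : ℕ → ℕ → ℕ) (s b : ℕ) : ℕ := dig b (tags dig b s).length

section tags

variable (dig : ℕ → ℕ → ℕ) (b : ℕ)

theorem tags_succ_eq_or (s : ℕ) :
    tags dig b (s + 1) = tags dig b s ∨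
      tags dig b (s + 1) = s.unpair.1 :: tags dig b s ∧ s.unpair.1 < tagBound b ∧
        s.unpair.1 ∉ tags dig b s ∧ Shows b (dig b (tags dig b s).length) s := by
  rw [tags]
  split_ifs with h
  · exact Or.inr ⟨rfl, h⟩
  · exact Or.inl rfl

theorem tags_valid (s : ℕ) : (tags dig b s).Nodup ∧ ∀ q ∈ tags dig b s, q < tagBound b := by
  induction s with
  | zero => simp [tags]
  | succ s ih =>
    rcases tags_succ_eq_or dig b s with h | ⟨h, h1, h2, -⟩ <;> rw [h]
    · exact ih
    · exact ⟨List.nodup_cons.2 ⟨h2, ih.1⟩, List.forall_mem_cons.2 ⟨h1, ih.2⟩⟩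

theorem length_tags_le (s : ℕ) : (tags dig b s).length ≤ tagBound b := by
  have h := tags_valid dig b s
  rw [← List.toFinset_card_of_nodup h.1, ← Finset.card_range (tagBound b)]
  exact Finset.card_le_card fun q hq => Finset.mem_range.2 (h.2 q (List.mem_toFinset.1 hq))

theorem length_tags_mono : Monotone fun s => (tags dig b s).length :=
  monotone_nat_of_le_succ fun s => by
    rcases tags_succ_eq_or dig b s with h | ⟨h, -⟩ <;> simp [h]

theorem tags_eventually_const : ∃ T, ∀ᶠ s in atTop, tags dig b s = T := by
  obtain ⟨l, s₀, hs₀⟩ :=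
    converges_of_monotone_of_bounded (length_tags_mono dig b) (length_tags_le dig b)
  refine ⟨tags dig b s₀, eventually_atTop.2 ⟨s₀, fun s hs => ?_⟩⟩
  induction s, hs using Nat.le_induction with
  | base => rfl
  | succ s hs ih =>
    rcases tags_succ_eq_or dig b s with h | ⟨h, -⟩
    · rw [h, ih]
    · have h1 := hs₀ s hs
      have h2 := hs₀ (s + 1) (by omega)
      simp only [h, List.length_cons] at h1 h2
      omega

/-- The tags used up at the base `b` in the limit. -/
noncomputable def limitTags : List ℕ := (tags_eventually_const dig b).choose

theorem tags_eventually_eq : ∀ᶠ s in atTop, tags dig b s = limitTags dig b :=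
  (tags_eventually_const dig b).choose_spec

theorem exists_of_mem_tags {q s : ℕ} (hq : q ∈ tags dig b s) :
    ∃ t, t.unpair.1 = q ∧ (tags dig b t).length < (tags dig b s).length ∧
      Shows b (dig b (tags dig b t).length) t := by
  induction s with
  | zero => simp [tags] at hq
  | succ s ih =>
    rcases tags_succ_eq_or dig b s with h | ⟨h, -, -, h3⟩
    · rw [h] at hq ⊢
      exact ih hq
    · rw [h, List.mem_cons] at hq
      rcases hq with rfl | hq
      · exact ⟨s, rfl, by simp [h], h3⟩
      · obtain ⟨t, h1, h2, h3⟩ := ih hq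
        exact ⟨t, h1, by rw [h, List.length_cons]; omega, h3⟩

theorem exists_of_mem_limitTags {q : ℕ} (hq : q ∈ limitTags dig b) :
    ∃ t, t.unpair.1 = q ∧ (tags dig b t).length < (limitTags dig b).length ∧
      Shows b (dig b (tags dig b t).length) t := by
  obtain ⟨s, hs⟩ := (tags_eventually_eq dig b).exists
  rw [← hs] at hq ⊢
  exact exists_of_mem_tags dig b hq

/-- Evidence is needed at arbitrarily late stages, since it must be met after the list has settled;
an unused tag would then enlarge it. -/
theorem mem_limitTags_of_shows {q : ℕ} (hq : q < tagBound b)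
    (h : ∃ᶠ s in atTop, s.unpair.1 = q ∧ Shows b (dig b (limitTags dig b).length) s) :
    q ∈ limitTags dig b := by
  have hev := (tags_eventually_eq dig b).and
    ((tendsto_add_atTop_nat 1).eventually (tags_eventually_eq dig b))
  obtain ⟨s, ⟨rfl, hs⟩, h1, h2⟩ := (h.and_eventually hev).exists
  by_contra hmem
  rw [tags, h1, if_pos ⟨hq, hmem, hs⟩] at h2
  have := congrArg List.length h2
  simp at this

end tags

/-- The digit at the base `b` in the limit. -/
noncomputable def limitDigit (dig : ℕ → ℕ → ℕ) (b : ℕ) : ℕ := dig b (limitTags dig b).length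

theorem markSet_tendsto (dig : ℕ → ℕ → ℕ) (m : ℕ) :
    ∀ᶠ s in atTop, (m ∈ markSet (digit dig s) ↔ m ∈ markSet (limitDigit dig)) := by
  have := (Filter.eventually_all_finite (Set.finite_Iic m)).2
    (fun b _ => tags_eventually_eq dig b)
  filter_upwards [this] with s hs
  have h : ∀ b ≤ m, digit dig s b = limitDigit dig b := fun b hb => by
    rw [digit, hs b hb, limitDigit]
  exact ⟨mem_markSet_of_agree h, mem_markSet_of_agree fun b hb => (h b hb).symm⟩

/-! ### Programs and bit masks for the approximations. -/

/-- The program `e` decides the relation `m ∈ D t`. -/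
def Decides (e : ℕ) (D : ℕ → Set ℕ) : Prop :=
  ∀ t m, (m ∈ D t → 1 ∈ (Denumerable.ofNat Nat.Partrec.Code e).eval (Nat.pair t m)) ∧
    (m ∉ D t → 0 ∈ (Denumerable.ofNat Nat.Partrec.Code e).eval (Nat.pair t m))

theorem exists_decides {D : ℕ → Set ℕ} (h : ComputablePred fun p : ℕ × ℕ => p.2 ∈ D p.1) :
    ∃ e, Decides e D := by
  obtain ⟨f, hf, hfD⟩ := ComputablePred.computable_iff.1 h
  have hc : Computable fun n : ℕ => bif f n.unpair then 1 else 0 :=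
    Computable.cond (hf.comp Primrec.unpair.to_comp) (Computable.const 1) (Computable.const 0)
  obtain ⟨c, hc⟩ := Nat.Partrec.Code.exists_code.1 (Partrec.nat_iff.1 hc)
  refine ⟨Encodable.encode c, fun t m => ?_⟩
  have hm : m ∈ D t ↔ f (t, m) = true := by
    have := congrFun hfD (t, m)
    simpa using this
  rw [Denumerable.ofNat_encode, hc, hm]
  constructor <;> intro h <;> simp_all

theorem Shows.mem_iff {b x s e : ℕ} {D : ℕ → Set ℕ} (h : Shows b x s) (he : Decides e D)
    (hs : s.unpair.1.unpair.1 = e) :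
    ∀ m ≤ s.unpair.2.unpair.1, (m ∈ D s.unpair.2.unpair.2.unpair.1 ↔
      (m < b ∧ s.unpair.1.unpair.2 / 2 ^ m % 2 = 1) ∨ m = s.unpair.2.unpair.1) := by
  intro m hm
  have h1 := Nat.Partrec.Code.evaln_sound (h.2.2 m (by omega))
  rw [hs] at h1
  have h2 := he s.unpair.2.unpair.2.unpair.1 m
  by_cases hmD : m ∈ D s.unpair.2.unpair.2.unpair.1
  · have := Part.mem_unique h1 (h2.1 hmD)
    simp only [hmD, true_iff]
    by_contra hcon
    simp [hcon] at this
  · have := Part.mem_unique h1 (h2.2 hmD)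
    simp only [hmD, false_iff]
    intro hcon
    simp [hcon] at this

theorem frequently_shows {b x e k t σ : ℕ} {D : ℕ → Set ℕ} (he : Decides e D)
    (hk₁ : nextBase^[x + 1] b ≤ k) (hk₂ : k < nextBase^[x + 2] b)
    (hD : ∀ m ≤ k, m ∈ D t ↔ (m < b ∧ σ / 2 ^ m % 2 = 1) ∨ m = k) :
    ∃ᶠ s in atTop, s.unpair.1 = Nat.pair e σ ∧ Shows b x s := by
  have hev : ∀ m ≤ k, ∀ᶠ u in atTop, Nat.Partrec.Code.evaln u
      (Denumerable.ofNat Nat.Partrec.Code e) (Nat.pair t m) =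
      some (if (m < b ∧ σ / 2 ^ m % 2 = 1) ∨ m = k then 1 else 0) := by
    intro m hm
    have : (if (m < b ∧ σ / 2 ^ m % 2 = 1) ∨ m = k then 1 else 0) ∈
        (Denumerable.ofNat Nat.Partrec.Code e).eval (Nat.pair t m) := by
      split_ifs with h
      · exact (he t m).1 ((hD m hm).2 h)
      · exact (he t m).2 (fun hc => h ((hD m hm).1 hc))
    obtain ⟨u, hu⟩ := Nat.Partrec.Code.evaln_complete.1 this
    exact eventually_atTop.2 ⟨u, fun v hv => Nat.Partrec.Code.evaln_mono hv hu⟩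
  have hall := (Filter.eventually_all_finite (Set.finite_Iic k)).2 hev
  rw [frequently_atTop]
  intro a
  obtain ⟨u, hu, hau⟩ := (hall.and (eventually_ge_atTop a)).exists
  -- The stage number is at least its step bound `u`, so enlarging `u` yields arbitrarily late
  -- stages.
  refine ⟨Nat.pair (Nat.pair e σ) (Nat.pair k (Nat.pair t u)), ?_, by simp, ?_⟩
  · exact hau.trans ((Nat.right_le_pair _ _).trans
      ((Nat.right_le_pair _ _).trans (Nat.right_le_pair _ _)))
  · refine ⟨by simpa using hk₁, by simpa using hk₂, fun m hm => ?_⟩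
    simp only [Nat.unpair_pair] at hm ⊢
    exact hu m (by simpa using Nat.lt_succ_iff.1 hm)

theorem exists_mask (D : Set ℕ) (b : ℕ) :
    ∃ σ < 2 ^ b, ∀ m < b, σ / 2 ^ m % 2 = 1 ↔ m ∈ D := by
  classical
  refine ⟨Nat.ofBits fun i : Fin b => decide ((i : ℕ) ∈ D), Nat.ofBits_lt_two_pow _,
    fun m hm => ?_⟩
  have := Nat.testBit_ofBits_lt (fun i : Fin b => decide ((i : ℕ) ∈ D)) m hm
  rw [Nat.testBit_eq_decide_div_mod_eq] at this
  simpa using this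

/-- Explains the size of `tagBound`: it leaves room for every program up to `b` and every mask of
length `b`. -/
theorem pair_lt_tagBound {b e σ : ℕ} (he : e ≤ b) (hσ : σ < 2 ^ b) :
    Nat.pair e σ < tagBound b := by
  have h1 : e < 2 ^ b := he.trans_lt Nat.lt_two_pow_self
  have h2 : max e σ + 1 ≤ 2 ^ b := by omega
  calc Nat.pair e σ < (max e σ + 1) ^ 2 := Nat.pair_lt_max_add_one_sq e σ
    _ ≤ (2 ^ b) ^ 2 := Nat.pow_le_pow_left h2 2
    _ = tagBound b := sq _

/-! ### A missed mark forces the next one to be missed. -/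

/-- The digits of a base, as a function of the number of used tags, move up along an increasing
approximation, or down along a decreasing one. -/
def Compatible (dig : ℕ → ℕ → ℕ) (D : ℕ → Set ℕ) (D' : Set ℕ) : Prop :=
  (∀ b i j, i < j → j ≤ tagBound b → dig b i < dig b j) ∧ (∀ t, LexLE (D t) D') ∨
  (∀ b i j, i < j → j ≤ tagBound b → dig b j < dig b i) ∧ (∀ t, LexLE D' (D t))

theorem next_mark_notMem {dig : ℕ → ℕ → ℕ} {e : ℕ} {D : ℕ → Set ℕ} {D' : Set ℕ}
    (he : Decides e D) (hlim : ∀ m, ∀ᶠ t in atTop, (m ∈ D t ↔ m ∈ D'))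
    (hdir : Compatible dig D D') {n : ℕ} (hen : e ≤ n)
    (hsub : ∀ m ∈ D', base (limitDigit dig) n ≤ m → m ∈ markSet (limitDigit dig))
    (hn : markAt (limitDigit dig) (base (limitDigit dig) n) ∉ D') :
    markAt (limitDigit dig) (base (limitDigit dig) (n + 1)) ∉ D' := by
  intro hk
  set δ := limitDigit dig with hδ
  set b := base δ n with hb
  set k := markAt δ (base δ (n + 1)) with hkdef
  have hgap : ∀ m ∈ D', b ≤ m → base δ (n + 1) ≤ m := by
    intro m hm hbm
    by_contra hlt
    exact hn (eq_mark_of_mem (hsub m hm hbm) hbm (not_le.1 hlt) ▸ hm)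
  have hkb : base δ (n + 1) ≤ k := le_markAt δ _
  have hkb' : k < nextBase (base δ (n + 1)) := markAt_lt δ _
  have hbb : b < base δ (n + 1) := base_strictMono δ n.lt_succ_self
  obtain ⟨σ, hσ, hσD⟩ := exists_mask D' b
  have hq : Nat.pair e σ < tagBound b :=
    pair_lt_tagBound (hen.trans (base_strictMono δ).le_apply) hσ
  -- If the next mark `k` were in `D'`, then `D'`, and so some `D t`, would show the pattern up to
  -- `k` against the limit digit.
  have hmem : Nat.pair e σ ∈ limitTags dig b := by
    obtain ⟨t, ht⟩ := (eventually_agree_le hlim k).exists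
    refine mem_limitTags_of_shows dig b hq (frequently_shows (k := k) (t := t) he ?_ ?_ ?_)
    · exact (base_succ δ n).symm.le.trans hkb
    · rw [show (dig b (limitTags dig b).length + 2) = δ b + 1 + 1 from rfl,
        Function.iterate_succ_apply', ← base_succ]
      exact hkb'
    · intro m hm
      rw [ht m hm]
      constructor
      · intro hmD
        by_cases hmb : m < b
        · exact Or.inl ⟨hmb, (hσD m hmb).2 hmD⟩
        · refine Or.inr (eq_mark_of_mem (hsub m hmD (not_lt.1 hmb)) (hgap m hmD (not_lt.1 hmb))
            (hm.trans_lt (hkb'.trans_le (nextBase_le_base_succ δ (n + 1)))))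
      · rintro (⟨hmb, h⟩ | rfl)
        · exact (hσD m hmb).1 h
        · exact hk
  -- The tag was used when fewer tags had been, so the digit `x` of that time differs strictly from
  -- the limit digit.
  obtain ⟨s, hs, hlen, hshow⟩ := exists_of_mem_limitTags dig b hmem
  have hs1 : s.unpair.1.unpair.1 = e := by rw [hs]; simp
  have hs2 : s.unpair.1.unpair.2 = σ := by rw [hs]; simp
  have hD := hshow.mem_iff he hs1
  rw [hs2] at hD
  obtain ⟨h1, h2, -⟩ := hshow
  set k₀ := s.unpair.2.unpair.1
  set t := s.unpair.2.unpair.2.unpair.1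
  set x := dig b (tags dig b s).length with hx
  have hbound : (limitTags dig b).length ≤ tagBound b := by
    obtain ⟨s', hs'⟩ := (tags_eventually_eq dig b).exists
    rw [← hs']
    exact length_tags_le dig b s'
  have hbk₀ : b < k₀ :=
    (iterate_nextBase_strictMono b (show 0 < x + 1 by omega)).trans_le h1
  rw [show x + 2 = x + 1 + 1 from rfl, Function.iterate_succ_apply'] at h2
  rcases hdir with ⟨hdig, hle⟩ | ⟨hdig, hle⟩
  -- Growing digits: `D t` and `D'` agree below `k₀`, so `k₀ ∈ D'`, although `k₀` now lies in the
  -- gap.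
  · have hlt : x < δ b := hdig b _ _ hlen hbound
    have hk₀ : k₀ < base δ (n + 1) := by
      rw [base_succ]
      exact h2.trans_le (nextBase_iterate_le hlt b)
    have : k₀ ∈ D' := by
      refine lexLE_iff.1 (hle t) k₀ (fun m hm => ?_) ((hD k₀ le_rfl).2 (Or.inr rfl))
      rw [hD m hm.le]
      constructor
      · rintro (⟨hmb, h⟩ | h)
        · exact (hσD m hmb).1 h
        · omega
      · intro hmD
        by_cases hmb : m < b
        · exact Or.inl ⟨hmb, (hσD m hmb).2 hmD⟩
        · have := hgap m hmD (not_lt.1 hmb)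
          omega
    have := hgap k₀ this hbk₀.le
    omega
  -- Shrinking digits: `k` now precedes `k₀`, so `k ∈ D'` forces `k ∈ D t`, but `D t` is empty from
  -- `b` up to `k₀`.
  · have hlt : δ b < x := hdig b _ _ hlen hbound
    have hkk₀ : k < k₀ := by
      have := nextBase_iterate_le hlt b
      rw [base_succ] at hkb'
      exact hkb'.trans_le (this.trans h1)
    have hkt := lexLE_iff.1 (hle t) k (fun m hm => ?_) hk
    · rcases (hD k hkk₀.le).1 hkt with h | h <;> omega
    · rw [hD m (by omega)]
      constructor
      · intro hmD
        by_cases hmb : m < b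
        · exact Or.inl ⟨hmb, (hσD m hmb).2 hmD⟩
        · have := eq_mark_of_mem (hsub m hmD (not_lt.1 hmb)) (hgap m hmD (not_lt.1 hmb))
            (hm.trans (hkb'.trans_le (nextBase_le_base_succ δ (n + 1))))
          omega
      · rintro (⟨hmb, h⟩ | h)
        · exact (hσD m hmb).1 h
        · omega

theorem markSet_diff_finite {dig : ℕ → ℕ → ℕ} {D : ℕ → Set ℕ} {D' : Set ℕ}
    (hcomp : ComputablePred fun p : ℕ × ℕ => p.2 ∈ D p.1)
    (hlim : ∀ m, ∀ᶠ t in atTop, (m ∈ D t ↔ m ∈ D')) (hdir : Compatible dig D D')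
    (hinf : D'.Infinite) (hsub : (D' \ markSet (limitDigit dig)).Finite) :
    (markSet (limitDigit dig) \ D').Finite := by
  obtain ⟨e, he⟩ := exists_decides hcomp
  obtain ⟨M, hM⟩ := hsub.bddAbove
  set δ := limitDigit dig
  have hsub' : ∀ n ≥ M + 1, ∀ m ∈ D', base δ n ≤ m → m ∈ markSet δ := by
    intro n hn m hm hbm
    by_contra hmem
    have h1 := hM (show m ∈ D' \ markSet δ from ⟨hm, hmem⟩)
    have h2 : n ≤ base δ n := (base_strictMono δ).le_apply
    omega
  by_cases hall : ∀ n ≥ max e (M + 1), markAt δ (base δ n) ∈ D'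
  · refine ((Set.finite_Iio (max e (M + 1))).image fun n => markAt δ (base δ n)).subset ?_
    rintro _ ⟨⟨n, rfl⟩, hn⟩
    exact ⟨n, not_le.1 fun h => hn (hall n h), rfl⟩
  · push Not at hall
    obtain ⟨n, hn, hnD⟩ := hall
    have hout : ∀ i ≥ n, markAt δ (base δ i) ∉ D' := by
      intro i hi
      induction i, hi using Nat.le_induction with
      | base => exact hnD
      | succ i hi ih => exact next_mark_notMem he hlim hdir (by omega) (hsub' i (by omega)) ih
    refine absurd ((Set.finite_Iio (base δ n)).subset fun m hm => ?_) hinf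
    by_contra hlt
    obtain ⟨i, rfl⟩ := hsub' n (by omega) m hm (not_lt.1 hlt)
    refine hout i ?_ hm
    have h1 : base δ n < base δ (i + 1) := (not_lt.1 hlt).trans_lt
      ((markAt_lt δ _).trans_le (nextBase_le_base_succ δ i))
    have := (base_strictMono δ).lt_iff_lt.1 h1
    omega

/-! ### Primitive recursiveness of the construction. -/

theorem primrec_two_pow : Primrec fun n : ℕ => 2 ^ n :=
  ((Primrec.nat_iterate Primrec.id (Primrec.const 1)
    (Primrec.nat_mul.comp (Primrec.const 2) Primrec.snd).to₂)).of_eq fun n => by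
      simp [← Nat.pow_eq]

theorem primrec_tagBound : Primrec tagBound :=
  Primrec.nat_mul.comp primrec_two_pow primrec_two_pow

theorem primrec_nextBase : Primrec nextBase :=
  Primrec.succ.comp (Primrec.nat_add.comp Primrec.id primrec_tagBound)

theorem primrec_nextBase_iterate {α : Type*} [Primcodable α] {f g : α → ℕ} (hf : Primrec f)
    (hg : Primrec g) : Primrec fun a => nextBase^[f a] (g a) :=
  Primrec.nat_iterate hf hg (primrec_nextBase.comp Primrec.snd).to₂

theorem primrecRel_forall_lt {β : Type*} [Primcodable β] {R : ℕ → β → Prop} (hR : PrimrecRel R) :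
    PrimrecRel fun n y => ∀ x < n, R x y :=
  (hR.forall_mem_list.comp (Primrec.list_range.comp Primrec.fst) Primrec.snd).of_eq (by simp)

theorem primrecRel_exists_lt {β : Type*} [Primcodable β] {R : ℕ → β → Prop} (hR : PrimrecRel R) :
    PrimrecRel fun n y => ∃ x < n, R x y :=
  (hR.exists_mem_list.comp (Primrec.list_range.comp Primrec.fst) Primrec.snd).of_eq (by simp)

theorem primrec_unpair_fst {α : Type*} [Primcodable α] {f : α → ℕ} (hf : Primrec f) :
    Primrec fun a => (f a).unpair.1 := Primrec.fst.comp (Primrec.unpair.comp hf)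

theorem primrec_unpair_snd {α : Type*} [Primcodable α] {f : α → ℕ} (hf : Primrec f) :
    Primrec fun a => (f a).unpair.2 := Primrec.snd.comp (Primrec.unpair.comp hf)

theorem primrecRel_evaln_eq {α : Type*} [Primcodable α] {u e t σ b k : α → ℕ} (hu : Primrec u)
    (he : Primrec e) (ht : Primrec t) (hσ : Primrec σ) (hb : Primrec b) (hk : Primrec k) :
    PrimrecRel fun (m : ℕ) (a : α) =>
      Nat.Partrec.Code.evaln (u a) (Denumerable.ofNat Nat.Partrec.Code (e a)) (Nat.pair (t a) m) =
      some (if (m < b a ∧ σ a / 2 ^ m % 2 = 1) ∨ m = k a then 1 else 0) := by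
  have hm : Primrec fun p : ℕ × α => p.1 := Primrec.fst
  have ha : Primrec fun p : ℕ × α => p.2 := Primrec.snd
  have hl : Primrec fun p : ℕ × α => Nat.Partrec.Code.evaln (u p.2)
      (Denumerable.ofNat Nat.Partrec.Code (e p.2)) (Nat.pair (t p.2) p.1) :=
    Nat.Partrec.Code.primrec_evaln.comp
      (((hu.comp ha).pair ((Primrec.ofNat Nat.Partrec.Code).comp (he.comp ha))).pair
        (Primrec₂.natPair.comp (ht.comp ha) hm))
  have hbit : Primrec fun p : ℕ × α => σ p.2 / 2 ^ p.1 % 2 :=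
    Primrec.nat_mod.comp (Primrec.nat_div.comp (hσ.comp ha) (primrec_two_pow.comp hm))
      (Primrec.const 2)
  have hc : PrimrecPred fun p : ℕ × α =>
      (p.1 < b p.2 ∧ σ p.2 / 2 ^ p.1 % 2 = 1) ∨ p.1 = k p.2 :=
    ((Primrec.nat_lt.comp hm (hb.comp ha)).and (Primrec.eq.comp hbit (Primrec.const 1))).or
      (Primrec.eq.comp hm (hk.comp ha))
  exact Primrec.eq.comp hl
    (Primrec.option_some.comp (Primrec.ite hc (Primrec.const 1) (Primrec.const 0)))

theorem primrecPred_shows {α : Type*} [Primcodable α] {f g h : α → ℕ} (hf : Primrec f)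
    (hg : Primrec g) (hh : Primrec h) : PrimrecPred fun a => Shows (f a) (g a) (h a) := by
  have hk := primrec_unpair_fst (primrec_unpair_snd hh)
  have htu := primrec_unpair_snd (primrec_unpair_snd hh)
  have hq := primrec_unpair_fst hh
  have h1 := Primrec.nat_le.comp
    (primrec_nextBase_iterate (Primrec.nat_add.comp hg (Primrec.const 1)) hf) hk
  have h2 := Primrec.nat_lt.comp hk
    (primrec_nextBase_iterate (Primrec.nat_add.comp hg (Primrec.const 2)) hf)
  have h3 := (primrecRel_forall_lt (primrecRel_evaln_eq (primrec_unpair_snd htu)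
    (primrec_unpair_fst hq) (primrec_unpair_fst htu) (primrec_unpair_snd hq) hf hk)).comp
    (Primrec.nat_add.comp hk (Primrec.const 1)) Primrec.id
  exact h1.and (h2.and h3)

theorem primrec_tags {dig : ℕ → ℕ → ℕ} (hdig : Primrec₂ dig) : Primrec₂ (tags dig) := by
  classical
  have hb : Primrec fun p : ℕ × ℕ × List ℕ => p.1 := Primrec.fst
  have hs : Primrec fun p : ℕ × ℕ × List ℕ => p.2.1 := Primrec.fst.comp Primrec.snd
  have hT : Primrec fun p : ℕ × ℕ × List ℕ => p.2.2 := Primrec.snd.comp Primrec.snd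
  have hq : Primrec fun p : ℕ × ℕ × List ℕ => p.2.1.unpair.1 :=
    Primrec.fst.comp (Primrec.unpair.comp hs)
  have hmem : PrimrecPred fun p : ℕ × ℕ × List ℕ => p.2.1.unpair.1 ∉ p.2.2 :=
    PrimrecPred.not ((Primrec.nat_lt.comp (Primrec.list_idxOf.comp hq hT)
      (Primrec.list_length.comp hT)).of_eq fun p => List.idxOf_lt_length_iff)
  have hstep : Primrec₂ fun (b : ℕ) (p : ℕ × List ℕ) =>
      if p.1.unpair.1 < tagBound b ∧ p.1.unpair.1 ∉ p.2 ∧ Shows b (dig b p.2.length) p.1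
      then p.1.unpair.1 :: p.2 else p.2 :=
    Primrec.ite ((Primrec.nat_lt.comp hq (primrec_tagBound.comp hb)).and
      (hmem.and (primrecPred_shows hb (hdig.comp hb (Primrec.list_length.comp hT)) hs)))
      (Primrec.list_cons.comp hq hT) hT
  refine (Primrec.nat_rec (Primrec.const []) hstep).of_eq fun b s => ?_
  induction s with
  | zero => rfl
  | succ s ih => simp only [tags, ← ih]

theorem computable_markSet {dig : ℕ → ℕ → ℕ} (hdig : Primrec₂ dig) :
    ComputablePred fun p : ℕ × ℕ => p.2 ∈ markSet (digit dig p.1) := by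
  have hdigit : Primrec₂ (digit dig) := hdig.comp Primrec.snd
    (Primrec.list_length.comp ((primrec_tags hdig).comp Primrec.snd Primrec.fst))
  have hbase : Primrec₂ fun s n => base (digit dig s) n := by
    refine Primrec.nat_iterate Primrec.snd (Primrec.const 0) ?_
    exact primrec_nextBase_iterate (Primrec.succ.comp
      (hdigit.comp (Primrec.fst.comp Primrec.fst) Primrec.snd)) Primrec.snd
  have hmark : Primrec₂ fun s n => markAt (digit dig s) (base (digit dig s) n) :=
    Primrec.nat_add.comp hbase (Primrec.nat_sub.comp (primrec_tagBound.comp hbase)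
      (hdigit.comp Primrec.fst hbase))
  have hR : PrimrecRel fun (n : ℕ) (p : ℕ × ℕ) =>
      markAt (digit dig p.1) (base (digit dig p.1) n) = p.2 :=
    Primrec.eq.comp (hmark.comp (Primrec.fst.comp Primrec.snd) Primrec.fst)
      (Primrec.snd.comp Primrec.snd)
  have := (primrecRel_exists_lt hR).comp (Primrec.succ.comp Primrec.snd) Primrec.id
  refine this.computablePred.of_eq fun p => ⟨?_, ?_⟩
  · rintro ⟨n, -, h⟩
    exact ⟨n, h⟩
  · rintro ⟨n, h⟩
    -- Marks increase strictly, so the `n`-th is at least `n` and the search is bounded.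
    refine ⟨n, Nat.lt_succ_iff.2 ?_, h⟩
    exact ((mark_strictMono _).le_apply).trans h.le

/-! ### The minimal and the maximal set. -/

theorem exists_minimal_leftRE : ∃ A : Set ℕ, IsMinimalLeftRE A := by
  set dig : ℕ → ℕ → ℕ := fun _ j => j with hdig
  refine ⟨markSet (limitDigit dig), ⟨fun s => markSet (digit dig s),
    computable_markSet Primrec.snd, fun s => ?_, markSet_tendsto dig⟩,
    ⟨by simp [AlmostSubset], by simpa using markSet_infinite _⟩, ?_⟩
  · exact markSet_lexLE (fun b => length_tags_mono dig b s.le_succ)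
      fun b => length_tags_le dig b (s + 1)
  · rintro ⟨E, ⟨S, hcomp, hmono, hlim⟩, ⟨-, hinf⟩, hsub, hdiff⟩
    rw [Set.sdiff_empty] at hinf
    exact hdiff (markSet_diff_finite hcomp hlim
      (Or.inl ⟨fun b i j h _ => h, lexLE_limit hmono hlim⟩) hinf hsub)

theorem exists_maximal_leftRE : ∃ B : Set ℕ, IsMaximalLeftRE B := by
  set dig : ℕ → ℕ → ℕ := fun b j => tagBound b - j with hdig
  have hprim : Primrec₂ dig :=
    Primrec.nat_sub.comp (primrec_tagBound.comp Primrec.fst) Primrec.snd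
  refine ⟨(markSet (limitDigit dig))ᶜ, ⟨fun s => (markSet (digit dig s))ᶜ,
    (computable_markSet hprim).not, fun s => LexLE.compl ?_,
    fun m => (markSet_tendsto dig m).mono fun s h => not_iff_not.2 h⟩,
    ⟨by simp [AlmostSubset], ?_⟩, ?_⟩
  · exact markSet_lexLE
      (fun b => Nat.sub_le_sub_left (length_tags_mono dig b s.le_succ) _)
      fun b => Nat.sub_le _ _
  · rw [← Set.compl_eq_univ_sdiff, compl_compl]
    exact markSet_infinite _
  · rintro ⟨E, ⟨S, hcomp, hmono, hlim⟩, ⟨hsub, hdiff⟩, -, hinf⟩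
    rw [← Set.compl_eq_univ_sdiff] at hinf
    have hlim' : ∀ m, ∀ᶠ s in atTop, (m ∈ (S s)ᶜ ↔ m ∈ Eᶜ) :=
      fun m => (hlim m).mono fun s h => not_iff_not.2 h
    refine hdiff ?_
    have := markSet_diff_finite (dig := dig) (D := fun s => (S s)ᶜ) hcomp.not hlim'
      -- The bound `j ≤ tagBound b` keeps the truncated subtraction strictly decreasing.
      (Or.inr ⟨fun b i j h hj => Nat.sub_lt_sub_left (h.trans_le hj) h,
        limit_lexLE (fun s => (hmono s).compl) hlim'⟩) hinf ?_
    · refine this.subset fun m hm => ⟨not_not.1 hm.2, not_not.2 hm.1⟩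
    · exact hsub.subset fun m hm => ⟨hm.2, hm.1⟩

theorem mainTheorem4 :
    (∃ A : Set ℕ, IsMinimalLeftRE A) ∧ (∃ B : Set ℕ, IsMaximalLeftRE B) :=
  ⟨exists_minimal_leftRE, exists_maximal_leftRE⟩
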